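/- Let $F$ be a field, $X$ a finite set, $F\langle X\rangle$ the free associative algebra on $X$ graded by word length, and $I$ a homogeneous two-sided ideal. Let $A=F\langle X\rangle/I=\bigoplus_{n\ge 0}A_n$ with the induced grading, $a_n=\dim_F A_n$, and let $H(A)=\limsup_{n\to\infty}\sqrt[n]{a_n}$ be the entropy of $A$. (a) Suppose that $\dim A_2=k=m^2+\ell$ with integers $m,\ell$ such that $1\le\ell\le 2m$. Then $$H(A)\le\frac{m+\sqrt{m^2+2\ell}}{2}<\sqrt{k}.$$ If $\ell=1$, then $H(A)\le m$. If $\ell=2m-3$, then $$H(A)\le\frac{m-1+\sqrt{m^2+6m-7}}{2}.$$ (b) For every integer $\ell\ge 0$ there is an $M(\ell)$, depending only on $\ell$, such that for every integer $m\ge M(\ell)$, with $p=\lfloor\ell/2\rfloor$ and $q=\lceil\ell/2\rceil$, the polynomial $t^3-mt^2-pt+mp-pq$ has a positive real root, and its largest positive root $\rho_{m,p,q}$ satisfies: for every field $F$, every finite set $X$ and every homogeneous two-sided ideal $I$ as above, $$\dim A_2=m^2+\ell\quad\Longrightarrow\quad H(A)\le\rho_{m,\lfloor\ell/2\rfloor,\lceil\ell/2\rceil}.$$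 -/

import Mathlib

namespace EntropyBounds

/-- The span of the letters in the free associative algebra `F⟨X⟩`. -/
def letters (F X : Type*) [Field F] : Submodule F (FreeAlgebra F X) :=
  Submodule.span F (Set.range (FreeAlgebra.ι F))

/-- The degree `n` part of `F⟨X⟩`: the `n`-th power of the span of the letters, that is, the
span of the words of length `n` (see `degreePart_eq_span_words`). -/
def degreePart (F X : Type*) [Field F] (n : ℕ) : Submodule F (FreeAlgebra F X) :=
  letters F X ^ n

open Pointwise in
/-- `degreePart F X n` is the span of the words of length `n`. -/
theorem degreePart_eq_span_words (F X : Type*) [Field F] (n : ℕ) :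
    degreePart F X n = Submodule.span F
      {w : FreeAlgebra F X | ∃ l : List X, l.length = n ∧ w = (l.map (FreeAlgebra.ι F)).prod} := by
  rw [degreePart, letters, Submodule.span_pow]
  congr 1
  induction n with
  | zero => ext w; simp [List.length_eq_zero_iff]
  | succ n ih =>
    rw [pow_succ', ih]
    ext w
    simp only [Set.mem_mul, Set.mem_range, Set.mem_ofPred_eq]
    constructor
    · rintro ⟨_, ⟨x, rfl⟩, _, ⟨l, hl, rfl⟩, rfl⟩
      exact ⟨x :: l, by simp [hl], by simp⟩
    · rintro ⟨l, hl, rfl⟩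
      cases l with
      | nil => simp at hl
      | cons x l => exact ⟨_, ⟨x, rfl⟩, _, ⟨l, by simpa using hl, rfl⟩, by simp⟩

theorem ι_mem_degreePart_one (F : Type*) {X : Type*} [Field F] (x : X) :
    FreeAlgebra.ι F x ∈ degreePart F X 1 := by
  rw [degreePart, pow_one]
  exact Submodule.subset_span ⟨x, rfl⟩

instance degreePart_gradedMonoid (F X : Type*) [Field F] :
    SetLike.GradedMonoid (degreePart F X) :=
  inferInstanceAs (SetLike.GradedMonoid (fun n : ℕ => letters F X ^ n))

open DirectSum in
/-- The grading of `F⟨X⟩` by word length. -/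
noncomputable instance freeAlgebraGraded (F X : Type*) [Field F] :
    GradedAlgebra (degreePart F X) :=
  GradedAlgebra.ofAlgHom _
    (FreeAlgebra.lift F fun x =>
      DirectSum.of (fun n : ℕ => degreePart F X n) 1 ⟨FreeAlgebra.ι F x, ι_mem_degreePart_one F x⟩)
    (by
      ext x
      simp [DirectSum.coeAlgHom_of])
    fun i x => by
      obtain ⟨x, hx⟩ := x
      dsimp only
      induction hx using Submodule.pow_induction_on_left' with
      | algebraMap r =>
        rw [AlgHom.commutes, DirectSum.algebraMap_apply]; rfl
      | add x y i hx hy ihx ihy =>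
        rw [map_add, ihx, ihy, ← map_add]
        rfl
      | mem_mul m hm i x hx ih =>
        rw [map_mul, ih]
        have key : ∀ m (hm : m ∈ letters F X),
            (FreeAlgebra.lift F fun x => DirectSum.of (fun n : ℕ => degreePart F X n) 1
              ⟨FreeAlgebra.ι F x, ι_mem_degreePart_one F x⟩) m
            = DirectSum.of (fun n : ℕ => degreePart F X n) 1
              ⟨m, by rw [degreePart, pow_one]; exact hm⟩ := by
          intro m hm
          induction hm using Submodule.span_induction with
          | mem y hy => obtain ⟨y, rfl⟩ := hy; simp
          | zero => rw [map_zero]; exact (map_zero _).symm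
          | add a b _ _ iha ihb => rw [map_add, iha, ihb, ← map_add]; rfl
          | smul c a _ iha =>
            rw [map_smul, iha]
            exact (DirectSum.lof F ℕ (fun n : ℕ => degreePart F X n) 1).map_smul c _ |>.symm
        rw [key m hm, DirectSum.of_mul_of]
        exact DirectSum.of_eq_of_gradedMonoid_eq (Sigma.subtype_ext (add_comm _ _) rfl)

/-- The degree `n` part `A_n` of the quotient `A = F⟨X⟩ / I`: the image of the degree `n` part of
the free algebra. -/
def quotientPart {F X : Type*} [Field F] (I : Ideal (FreeAlgebra F X)) [I.IsTwoSided] (n : ℕ) :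
    Submodule F (FreeAlgebra F X ⧸ I) :=
  (degreePart F X n).map (Ideal.Quotient.mkₐ F I).toLinearMap

/-- `a_n = dim A_n`. -/
noncomputable def hilbertFn {F X : Type*} [Field F] (I : Ideal (FreeAlgebra F X)) [I.IsTwoSided]
    (n : ℕ) : ℕ :=
  Module.finrank F (quotientPart I n)

/-- The entropy `H(A) = limsup a_n ^ (1 / n)` of `A = F⟨X⟩ / I`. For finite `X` the sequence lies
in the interval `[0, max 1 |X|]`, so the real limsup is the true one. -/
noncomputable def entropy {F X : Type*} [Field F] (I : Ideal (FreeAlgebra F X)) [I.IsTwoSided] :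
    ℝ :=
  Filter.limsup (fun n : ℕ => (hilbertFn I n : ℝ) ^ (1 / (n : ℝ))) Filter.atTop

/-- `ρ` is the largest positive real root of `t³ - m t² - p t + m p - p q`. -/
def IsLargestPositiveRoot (m p q : ℕ) (ρ : ℝ) : Prop :=
  IsGreatest {t : ℝ | 0 < t ∧ t ^ 3 - m * t ^ 2 - p * t + m * p - p * q = 0} ρ

end EntropyBounds

universe u v

/-
Order the letters. Modulo smaller words, every word reduces to one all of whose factors of length
two are normal, so `dim Aₙ` is at most the number of walks with `n - 1` edges in the digraph of
normal pairs, which has exactly `dim A₂` edges. Among digraphs with given out-degrees the walks are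
most numerous when the out-neighbourhoods are initial segments of the vertices ordered by degree;
the edge set is then a Young diagram `μ` with `dim A₂` cells, and its growth has to be bounded.

Let `d` be the side of the Durfee square of `μ`, `N` the number of cells in the smaller one of the
two parts outside the square, and `P = ∑ j ≥ d, colLen j * rowLen j`. A positive supersolution `x`
of the adjacency operator, `∑ j < rowLen i, x j ≤ t * x i`, forces growth `O(tⁿ)`, and an explicit
one exists as soon as `N < t²` and `P ≤ (t - d) * (t² - N)`. For `dim A₂ = m² + ℓ` with `ℓ ≤ 2m` one
has `d ≤ m` and `2N ≤ m² + ℓ - d²`. The estimate `P ≤ d * N` gives the general bound of (a). For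
`d = m` the estimate `P ≤ N * (ℓ - N)` gives the root of `(t - m) * (t² - p) = p * q`. For
`d = m - r` with `r > 0` one has growth at most `m`: if `ℓ ≤ r²` by the first estimate, otherwise,
for `m` large, because `P` is at most about `d² * r`.
-/

namespace EntropyBounds

open Finset

section Digraph

variable {X : Type*} [DecidableEq X] {E : Finset (X × X)} {s t : ℝ}

/-- The number of walks with `n` edges that start at `x`, in the digraph with edge set `E`. -/
def walkCount (E : Finset (X × X)) : ℕ → X → ℕ
  | 0, _ => 1
  | n + 1, x => ∑ e ∈ E with e.1 = x, walkCount E n e.2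

/-- The number of walks with `n + 1` edges in the digraph with edge set `E`. At least one edge is
required so that vertices outside all edges do not matter and `X` may be infinite. -/
def edgeWalkCount (E : Finset (X × X)) (n : ℕ) : ℕ :=
  ∑ e ∈ E, walkCount E n e.2

/-- The out-degree of the vertex `x` in the digraph with edge set `E`. -/
def outDegree (E : Finset (X × X)) (x : X) : ℕ :=
  #{e ∈ E | e.1 = x}

/-- The number of walks with `n` edges is `O(t ^ n)`: in the digraph with edge set `E` it has
exponential growth rate at most `t`. -/
def HasGrowth (E : Finset (X × X)) (t : ℝ) : Prop :=
  ∃ K : ℝ, ∀ n, (edgeWalkCount E n : ℝ) ≤ K * t ^ n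

theorem HasGrowth.mono (h : HasGrowth E s) (hs : 0 ≤ s) (hst : s ≤ t) : HasGrowth E t := by
  obtain ⟨K, hK⟩ := h
  refine ⟨|K|, fun n => (hK n).trans ?_⟩
  gcongr
  exact le_abs_self K

theorem sum_walkCount_succ (E : Finset (X × X)) (S : Finset X) (n : ℕ) :
    ∑ x ∈ S, walkCount E (n + 1) x = ∑ e ∈ E with e.1 ∈ S, walkCount E n e.2 :=
  sum_fiberwise_eq_sum_filter E S Prod.fst fun e => walkCount E n e.2

theorem sum_walkCount_succ_le (E : Finset (X × X)) (S : Finset X) (n : ℕ) :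
    ∑ x ∈ S, walkCount E (n + 1) x ≤ edgeWalkCount E n :=
  (sum_walkCount_succ E S n).trans_le (sum_le_sum_of_subset (filter_subset _ _))

theorem sum_image_fst_walkCount_succ (E : Finset (X × X)) (n : ℕ) :
    ∑ x ∈ E.image Prod.fst, walkCount E (n + 1) x = edgeWalkCount E n :=
  sum_fiberwise_of_maps_to (fun _ => mem_image_of_mem Prod.fst) fun e => walkCount E n e.2

/-- The edge set of the digraph obtained by reversing all edges. -/
def reverse (E : Finset (X × X)) : Finset (X × X) :=
  E.map (Equiv.prodComm X X).toEmbedding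

theorem walkCount_reverse_succ (E : Finset (X × X)) (n : ℕ) (x : X) :
    walkCount (reverse E) (n + 1) x = ∑ e ∈ E with e.2 = x, walkCount (reverse E) n e.1 := by
  rw [walkCount, sum_filter, sum_filter]
  exact sum_map E _ _

/-- Both sides count the walks consisting of `k` edges, an edge of `E`, another edge and `n` more
edges, decomposed at the first or at the second of the two middle edges. -/
theorem sum_walkCount_reverse_mul_succ (E : Finset (X × X)) (k n : ℕ) :
    ∑ e ∈ E, walkCount (reverse E) k e.1 * walkCount E (n + 1) e.2 =
      ∑ f ∈ E, walkCount (reverse E) (k + 1) f.1 * walkCount E n f.2 := by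
  simp only [walkCount_reverse_succ]
  simp only [walkCount, mul_sum, sum_mul]
  exact sum_comm' fun e f => by
    simp only [mem_filter]
    tauto

theorem sum_walkCount_reverse_mul (E : Finset (X × X)) (k n : ℕ) :
    ∑ e ∈ E, walkCount (reverse E) k e.1 * walkCount E n e.2 =
      ∑ e ∈ E, walkCount (reverse E) (k + n) e.1 := by
  induction n generalizing k with
  | zero => simp only [walkCount, mul_one, add_zero]
  | succ n ih => rw [sum_walkCount_reverse_mul_succ, ih, add_right_comm, add_assoc]

theorem edgeWalkCount_reverse (E : Finset (X × X)) (n : ℕ) :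
    edgeWalkCount (reverse E) n = edgeWalkCount E n :=
  calc edgeWalkCount (reverse E) n = ∑ e ∈ E, walkCount (reverse E) n e.1 := sum_map E _ _
    _ = ∑ e ∈ E, walkCount (reverse E) 0 e.1 * walkCount E n e.2 := by
      rw [sum_walkCount_reverse_mul, zero_add]
    _ = edgeWalkCount E n := by simp only [walkCount, one_mul, edgeWalkCount]

theorem hasGrowth_reverse : HasGrowth (reverse E) t ↔ HasGrowth E t := by
  simp only [HasGrowth, edgeWalkCount_reverse]

/-- Collatz–Wielandt: a supersolution `x` of the adjacency operator bounds its growth. -/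
theorem hasGrowth_of_sum_le {x : X → ℝ} {K : ℝ} (ht : 0 ≤ t) (hK : 0 ≤ K)
    (hdeg : ∀ v, outDegree E v ≤ K * x v) (hsum : ∀ v, ∑ e ∈ E with e.1 = v, x e.2 ≤ t * x v) :
    HasGrowth E t := by
  have key (n : ℕ) (v : X) : (walkCount E (n + 1) v : ℝ) ≤ K * x v * t ^ n := by
    induction n generalizing v with
    | zero => simpa [walkCount, outDegree] using hdeg v
    | succ n ih =>
      calc (walkCount E (n + 1 + 1) v : ℝ)
          = ∑ e ∈ E with e.1 = v, (walkCount E (n + 1) e.2 : ℝ) := by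
            rw [walkCount, Nat.cast_sum]
        _ ≤ ∑ e ∈ E with e.1 = v, K * x e.2 * t ^ n := sum_le_sum fun e _ => ih e.2
        _ = K * t ^ n * ∑ e ∈ E with e.1 = v, x e.2 := by
            rw [mul_sum]; exact sum_congr rfl fun e _ => by ring
        _ ≤ K * t ^ n * (t * x v) := by gcongr; exact hsum v
        _ = K * x v * t ^ (n + 1) := by ring
  refine ⟨∑ v ∈ E.image Prod.fst, K * x v, fun n => ?_⟩
  rw [← sum_image_fst_walkCount_succ, Nat.cast_sum, sum_mul]
  exact sum_le_sum fun v _ => key n v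

/-- The walks with `n` edges in the digraph with edge set `E` starting at `x`, as lists of
vertices. -/
def walks (E : Finset (X × X)) : ℕ → X → Finset (List X)
  | 0, x => {[x]}
  | n + 1, x => {e ∈ E | e.1 = x}.biUnion fun e => (walks E n e.2).image (List.cons x)

theorem card_walks_le (E : Finset (X × X)) (n : ℕ) (x : X) : #(walks E n x) ≤ walkCount E n x := by
  induction n generalizing x with
  | zero => simp [walks, walkCount]
  | succ n ih =>
    exact card_biUnion_le.trans (sum_le_sum fun e _ => card_image_le.trans (ih e.2))

theorem mem_walks_of_isChain {x : X} {l : List X} (h : (x :: l).IsChain fun a b => (a, b) ∈ E) :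
    x :: l ∈ walks E l.length x := by
  induction l generalizing x with
  | nil => simp [walks]
  | cons y l ih =>
    rw [List.isChain_cons_cons] at h
    exact mem_biUnion.2 ⟨(x, y), mem_filter.2 ⟨h.1, rfl⟩, mem_image_of_mem _ (ih h.2)⟩

end Digraph

section DegreeDiagram

theorem filter_range_lt (n k : ℕ) : {i ∈ range n | i < k} = range (min n k) := by
  rw [← Nat.Iio_eq_range, Iio_filter_lt, Nat.Iio_eq_range]

theorem sum_sum_range_eq {X M : Type*} [AddCommMonoid M] (S : Finset X) {a : X → ℕ} {N : ℕ}
    (ha : ∀ x ∈ S, a x ≤ N) (g : ℕ → M) :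
    ∑ x ∈ S, ∑ j ∈ range (a x), g j = ∑ j ∈ range N, #{x ∈ S | j < a x} • g j := by
  have hrange : ∀ x ∈ S, ∑ j ∈ range (a x), g j = ∑ j ∈ range N with j < a x, g j := fun x hx => by
    rw [filter_range_lt, min_eq_right (ha x hx)]
  rw [sum_congr rfl hrange]
  simp only [sum_filter, ← sum_const]
  exact sum_comm

theorem sum_sum_range_le_of_card_filter_le {X Y : Type*} {S : Finset X} {T : Finset Y}
    {a : X → ℕ} {b : Y → ℕ} (h : ∀ j, #{x ∈ S | j < a x} ≤ #{y ∈ T | j < b y}) (g : ℕ → ℕ) :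
    ∑ x ∈ S, ∑ j ∈ range (a x), g j ≤ ∑ y ∈ T, ∑ j ∈ range (b y), g j := by
  rw [sum_sum_range_eq S (N := S.sup a + T.sup b) fun x hx => (le_sup hx).trans le_self_add,
    sum_sum_range_eq T (N := S.sup a + T.sup b) fun y hy => (le_sup hy).trans le_add_self]
  exact sum_le_sum fun j _ => Nat.mul_le_mul_right _ (h j)

theorem card_filter_range_lt_rowLen (μ : YoungDiagram) (k j : ℕ) :
    #{i ∈ range k | j < μ.rowLen i} = min k (μ.colLen j) := by
  simp only [← YoungDiagram.mem_iff_lt_rowLen, YoungDiagram.mem_iff_lt_colLen]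
  rw [filter_range_lt, card_range]

theorem sum_cells_fst_eq {M : Type*} [AddCommMonoid M] (μ : YoungDiagram) (i : ℕ) (x : ℕ → M) :
    ∑ e ∈ μ.cells with e.1 = i, x e.2 = ∑ j ∈ range (μ.rowLen i), x j := by
  rw [← YoungDiagram.row, YoungDiagram.row_eq_prod, sum_product, sum_singleton]

variable {X : Type*} [DecidableEq X] {E : Finset (X × X)} {t : ℝ}

theorem sum_outDegree (E : Finset (X × X)) : ∑ x ∈ E.image Prod.fst, outDegree E x = #E :=
  (card_eq_sum_card_image Prod.fst E).symm

theorem outDegree_le_card (E : Finset (X × X)) (x : X) : outDegree E x ≤ #E :=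
  card_filter_le _ _

/-- The Young diagram whose row lengths are the out-degrees of the digraph with edge set `E`, in
decreasing order. It is defined through its columns: the `j`-th column counts the vertices of
out-degree greater than `j`, so that no ordering of the vertices has to be chosen. -/
def degreeDiagram (E : Finset (X × X)) : YoungDiagram where
  cells := {c ∈ range #E ×ˢ range #E | c.1 < #{x ∈ E.image Prod.fst | c.2 < outDegree E x}}
  isLowerSet := by
    rintro ⟨i, j⟩ ⟨i', j'⟩ ⟨hi : i' ≤ i, hj : j' ≤ j⟩ h
    simp only [coe_filter, mem_product, mem_range, Set.mem_ofPred_eq] at h ⊢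
    refine ⟨⟨hi.trans_lt h.1.1, hj.trans_lt h.1.2⟩, hi.trans_lt (h.2.trans_le ?_)⟩
    exact card_le_card (monotone_filter_right _ fun x _ => hj.trans_lt)

theorem colLen_degreeDiagram (E : Finset (X × X)) (j : ℕ) :
    (degreeDiagram E).colLen j = #{x ∈ E.image Prod.fst | j < outDegree E x} := by
  refine eq_of_forall_lt_iff fun i => ?_
  refine YoungDiagram.mem_iff_lt_colLen.symm.trans (mem_filter.trans ?_)
  rw [mem_product, mem_range, mem_range, and_iff_right_iff_imp]
  intro hi
  obtain ⟨x, hx⟩ := card_pos.1 (i.zero_le.trans_lt hi)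
  exact ⟨hi.trans_le ((card_filter_le _ _).trans card_image_le),
    (mem_filter.1 hx).2.trans_le (outDegree_le_card E x)⟩

theorem card_degreeDiagram (E : Finset (X × X)) : (degreeDiagram E).card = #E := by
  have hsnd : ∀ c ∈ (degreeDiagram E).cells, c.2 ∈ range #E := fun c hc =>
    (mem_product.1 (mem_filter.1 hc).1).2
  calc (degreeDiagram E).card = ∑ j ∈ range #E, (degreeDiagram E).colLen j := by
        simp only [YoungDiagram.colLen_eq_card]
        exact card_eq_sum_card_fiberwise hsnd
    _ = ∑ x ∈ E.image Prod.fst, ∑ _j ∈ range (outDegree E x), 1 := by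
        rw [sum_sum_range_eq _ fun x _ => outDegree_le_card E x]
        simp only [colLen_degreeDiagram, smul_eq_mul, mul_one]
    _ = #E := by simp only [sum_const, card_range, smul_eq_mul, mul_one, sum_outDegree]

theorem card_filter_lt_outDegree_le (E : Finset (X × X)) (S : Finset X) (j : ℕ) :
    #{x ∈ S | j < outDegree E x} ≤ #{i ∈ range #S | j < (degreeDiagram E).rowLen i} := by
  rw [card_filter_range_lt_rowLen, colLen_degreeDiagram]
  refine le_min (card_filter_le _ _) (card_le_card fun x hx => ?_)
  obtain ⟨-, hj⟩ := mem_filter.1 hx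
  obtain ⟨e, he⟩ := card_pos.1 (j.zero_le.trans_lt hj)
  obtain ⟨heE, rfl⟩ := mem_filter.1 he
  exact mem_filter.2 ⟨mem_image_of_mem _ heE, hj⟩

/-- The out-neighbourhoods in the Young diagram are initial segments of the vertices ordered by
decreasing degree, so they are the best possible ones at every step of the walk. -/
theorem sum_walkCount_le_degreeDiagram (E : Finset (X × X)) (n : ℕ) (S : Finset X) :
    ∑ x ∈ S, walkCount E n x ≤ ∑ i ∈ range #S, walkCount (degreeDiagram E).cells n i := by
  induction n generalizing S with
  | zero => simp [walkCount]
  | succ n ih =>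
    have hinj (x : X) : Set.InjOn Prod.snd ({e ∈ E | e.1 = x} : Set (X × X)) :=
      fun e he f hf h => Prod.ext (he.2.trans hf.2.symm) h
    calc ∑ x ∈ S, walkCount E (n + 1) x
        = ∑ x ∈ S, ∑ y ∈ {e ∈ E | e.1 = x}.image Prod.snd, walkCount E n y :=
          sum_congr rfl fun x _ => by rw [walkCount, sum_image (by simpa using hinj x)]
      _ ≤ ∑ x ∈ S, ∑ j ∈ range (outDegree E x), walkCount (degreeDiagram E).cells n j :=
          sum_le_sum fun x _ => (ih _).trans_eq (by
            rw [card_image_of_injOn (by simpa using hinj x), outDegree])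
      _ ≤ ∑ i ∈ range #S, ∑ j ∈ range ((degreeDiagram E).rowLen i),
            walkCount (degreeDiagram E).cells n j :=
          sum_sum_range_le_of_card_filter_le (card_filter_lt_outDegree_le E S) _
      _ = ∑ i ∈ range #S, walkCount (degreeDiagram E).cells (n + 1) i := by
          simp only [walkCount, sum_cells_fst_eq]

theorem hasGrowth_of_hasGrowth_degreeDiagram (h : HasGrowth (degreeDiagram E).cells t) :
    HasGrowth E t := by
  obtain ⟨K, hK⟩ := h
  refine ⟨K, fun n => le_trans ?_ (hK n)⟩
  rw [← sum_image_fst_walkCount_succ]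
  exact_mod_cast (sum_walkCount_le_degreeDiagram E (n + 1) _).trans (sum_walkCount_succ_le _ _ n)

end DegreeDiagram

section Durfee

variable (μ : YoungDiagram)

theorem card_transpose : μ.transpose.card = μ.card :=
  card_map _

theorem cells_transpose : μ.transpose.cells = reverse μ.cells :=
  rfl

theorem rowLen_le_card (i : ℕ) : μ.rowLen i ≤ μ.card := by
  rw [YoungDiagram.rowLen_eq_card]
  exact card_filter_le _ _

theorem colLen_le_card (j : ℕ) : μ.colLen j ≤ μ.card := by
  rw [YoungDiagram.colLen_eq_card]
  exact card_filter_le _ _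

theorem lt_rowLen_iff_lt_colLen {i j : ℕ} : j < μ.rowLen i ↔ i < μ.colLen j := by
  rw [← YoungDiagram.mem_iff_lt_rowLen, YoungDiagram.mem_iff_lt_colLen]

theorem card_eq_sum_rowLen : μ.card = ∑ i ∈ range μ.card, μ.rowLen i := by
  simp only [YoungDiagram.rowLen_eq_card]
  refine card_eq_sum_card_fiberwise fun c hc => mem_coe.2 (mem_range.2 ?_)
  exact (YoungDiagram.mem_iff_lt_colLen.1 hc).trans_le (colLen_le_card μ c.2)

theorem exists_diag_notMem : ∃ i, (i, i) ∉ μ :=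
  ⟨μ.card, fun h => (YoungDiagram.mem_iff_lt_rowLen.1 h).not_ge (rowLen_le_card μ _)⟩

/-- The side length of the Durfee square, the largest square contained in a Young diagram. -/
def durfee : ℕ :=
  Nat.find (exists_diag_notMem μ)

theorem lt_durfee_iff {i : ℕ} : i < durfee μ ↔ i < μ.rowLen i := by
  rw [durfee, Nat.lt_find_iff, ← YoungDiagram.mem_iff_lt_rowLen]
  exact ⟨fun h => not_not.1 (h i le_rfl), fun h k hk => not_not.2 (μ.up_left_mem hk hk h)⟩

theorem durfee_transpose : durfee μ.transpose = durfee μ :=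
  eq_of_forall_lt_iff fun i => by
    rw [lt_durfee_iff, lt_durfee_iff, YoungDiagram.rowLen_transpose, lt_rowLen_iff_lt_colLen]

theorem rowLen_le_durfee {i : ℕ} (hi : durfee μ ≤ i) : μ.rowLen i ≤ durfee μ :=
  (μ.rowLen_anti _ _ hi).trans (not_lt.1 fun h => ((lt_durfee_iff μ).2 h).false)

theorem colLen_le_durfee {j : ℕ} (hj : durfee μ ≤ j) : μ.colLen j ≤ durfee μ := by
  rw [← durfee_transpose] at hj ⊢
  exact (μ.rowLen_transpose j).symm.trans_le (rowLen_le_durfee μ.transpose hj)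

theorem durfee_le_rowLen {i : ℕ} (hi : i < durfee μ) : durfee μ ≤ μ.rowLen i := by
  refine le_of_forall_lt fun j hj => YoungDiagram.mem_iff_lt_rowLen.1 ?_
  have hdiag := (lt_durfee_iff μ).1 (max_lt hi hj)
  exact μ.up_left_mem (le_max_left i j) (le_max_right i j) (YoungDiagram.mem_iff_lt_rowLen.2 hdiag)

theorem durfee_le_card : durfee μ ≤ μ.card :=
  not_lt.1 fun h => ((lt_durfee_iff μ).1 h).not_ge (rowLen_le_card μ _)

/-- The number of cells below the Durfee square. -/
def lowerLeg : ℕ :=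
  ∑ i ∈ Ico (durfee μ) μ.card, μ.rowLen i

/-- The number of cells to the right of the Durfee square. -/
def rightLeg : ℕ :=
  ∑ j ∈ Ico (durfee μ) μ.card, μ.colLen j

/-- The number of walks with two edges whose middle vertex lies beyond the Durfee square. -/
def legProduct : ℕ :=
  ∑ j ∈ Ico (durfee μ) μ.card, μ.colLen j * μ.rowLen j

/-- The number of cells in the smaller one of the two parts of the diagram outside the Durfee
square. -/
def minLeg : ℕ :=
  min (lowerLeg μ) (rightLeg μ)

theorem lowerLeg_transpose : lowerLeg μ.transpose = rightLeg μ := by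
  simp only [lowerLeg, rightLeg, durfee_transpose, card_transpose, YoungDiagram.rowLen_transpose]

theorem legProduct_transpose : legProduct μ.transpose = legProduct μ := by
  simp only [legProduct, durfee_transpose, card_transpose, YoungDiagram.colLen_transpose,
    YoungDiagram.rowLen_transpose, mul_comm]

theorem sum_range_durfee_sum_Ico_rowLen {M : Type*} [AddCommMonoid M] (g : ℕ → M) :
    ∑ i ∈ range (durfee μ), ∑ j ∈ Ico (durfee μ) (μ.rowLen i), g j =
      ∑ j ∈ Ico (durfee μ) μ.card, μ.colLen j • g j := by
  have hmem (i j : ℕ) : i ∈ range (durfee μ) ∧ j ∈ Ico (durfee μ) (μ.rowLen i) ↔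
      i ∈ range (μ.colLen j) ∧ j ∈ Ico (durfee μ) μ.card := by
    simp only [mem_range, mem_Ico, lt_rowLen_iff_lt_colLen]
    constructor
    · rintro ⟨-, hj, hi⟩
      exact ⟨hi, hj, ((lt_rowLen_iff_lt_colLen μ).2 hi).trans_le (rowLen_le_card μ i)⟩
    · rintro ⟨hi, hj, -⟩
      exact ⟨hi.trans_le (colLen_le_durfee μ hj), hj, hi⟩
  rw [sum_comm' hmem]
  simp only [sum_const, card_range]

theorem durfee_sq_add_lowerLeg_add_rightLeg :
    durfee μ ^ 2 + lowerLeg μ + rightLeg μ = μ.card := by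
  have hrow : ∀ i ∈ range (durfee μ),
      μ.rowLen i = durfee μ + ∑ _j ∈ Ico (durfee μ) (μ.rowLen i), 1 := fun i hi => by
    rw [sum_const, Nat.card_Ico, smul_eq_mul, mul_one,
      Nat.add_sub_cancel' (durfee_le_rowLen μ (mem_range.1 hi))]
  have hsquare : ∑ i ∈ range (durfee μ), μ.rowLen i = durfee μ ^ 2 + rightLeg μ := by
    rw [sum_congr rfl hrow, sum_add_distrib, sum_const, card_range, smul_eq_mul, ← sq,
      sum_range_durfee_sum_Ico_rowLen, rightLeg]
    simp only [smul_eq_mul, mul_one]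
  rw [card_eq_sum_rowLen, ← sum_range_add_sum_Ico _ (durfee_le_card μ), hsquare, ← lowerLeg]
  ring

theorem two_mul_minLeg_add_durfee_sq_le : 2 * minLeg μ + durfee μ ^ 2 ≤ μ.card := by
  have := durfee_sq_add_lowerLeg_add_rightLeg μ
  have := min_le_left (lowerLeg μ) (rightLeg μ)
  have := min_le_right (lowerLeg μ) (rightLeg μ)
  rw [minLeg]
  lia

theorem legProduct_le_durfee_mul_lowerLeg : legProduct μ ≤ durfee μ * lowerLeg μ := by
  rw [legProduct, lowerLeg, mul_sum]
  refine sum_le_sum fun j hj => Nat.mul_le_mul_right _ ?_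
  exact colLen_le_durfee μ (mem_Ico.1 hj).1

theorem legProduct_le_durfee_mul_minLeg : legProduct μ ≤ durfee μ * minLeg μ := by
  rw [minLeg, ← Nat.mul_min_mul_left]
  refine le_min (legProduct_le_durfee_mul_lowerLeg μ) ?_
  simpa only [legProduct_transpose, durfee_transpose, lowerLeg_transpose] using
    legProduct_le_durfee_mul_lowerLeg μ.transpose

theorem legProduct_le_lowerLeg_mul_rightLeg : legProduct μ ≤ lowerLeg μ * rightLeg μ := by
  rw [legProduct, mul_comm, lowerLeg, mul_sum]
  refine sum_le_sum fun j hj => Nat.mul_le_mul_right _ ?_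
  exact single_le_sum (f := μ.colLen) (fun _ _ => Nat.zero_le _) hj

theorem legProduct_le_minLeg_mul :
    (legProduct μ : ℝ) ≤ minLeg μ * (μ.card - durfee μ ^ 2 - minLeg μ) := by
  have hprod : (legProduct μ : ℝ) ≤ lowerLeg μ * rightLeg μ := by
    exact_mod_cast legProduct_le_lowerLeg_mul_rightLeg μ
  have hcard : (durfee μ : ℝ) ^ 2 + lowerLeg μ + rightLeg μ = μ.card := by
    exact_mod_cast durfee_sq_add_lowerLeg_add_rightLeg μ
  rw [minLeg, ← hcard]
  rcases min_choice (lowerLeg μ) (rightLeg μ) with h | h <;> rw [h] <;> linarith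

end Durfee

section Growth

variable {μ : YoungDiagram} {t : ℝ}

/-- A supersolution for walks in a Young diagram. Of the two-step operator it retains the value
`t² - lowerLeg μ` on the vertices of the Durfee square; the remaining terms are the contributions
of the edges leaving the square. -/
noncomputable def durfeeWeight (μ : YoungDiagram) (t : ℝ) (i : ℕ) : ℝ :=
  if i < durfee μ then t ^ 2 - lowerLeg μ + ∑ j ∈ Ico (durfee μ) (μ.rowLen i), (μ.rowLen j : ℝ)
  else t * μ.rowLen i

theorem durfeeWeight_of_lt {i : ℕ} (hi : i < durfee μ) : durfeeWeight μ t i =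
    t ^ 2 - lowerLeg μ + ∑ j ∈ Ico (durfee μ) (μ.rowLen i), (μ.rowLen j : ℝ) :=
  if_pos hi

theorem durfeeWeight_of_le {i : ℕ} (hi : durfee μ ≤ i) : durfeeWeight μ t i = t * μ.rowLen i :=
  if_neg hi.not_gt

theorem sum_Ico_rowLen_le_lowerLeg (μ : YoungDiagram) (i : ℕ) :
    ∑ j ∈ Ico (durfee μ) (μ.rowLen i), μ.rowLen j ≤ lowerLeg μ :=
  sum_le_sum_of_subset (Ico_subset_Ico_right (rowLen_le_card μ i))

theorem sum_range_durfee_durfeeWeight (μ : YoungDiagram) (t : ℝ) :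
    ∑ j ∈ range (durfee μ), durfeeWeight μ t j =
      durfee μ * (t ^ 2 - lowerLeg μ) + legProduct μ := by
  rw [sum_congr rfl fun j hj => durfeeWeight_of_lt (mem_range.1 hj), sum_add_distrib, sum_const,
    card_range, nsmul_eq_mul, sum_range_durfee_sum_Ico_rowLen, legProduct, Nat.cast_sum]
  simp only [nsmul_eq_mul, Nat.cast_mul]

theorem sum_durfeeWeight_le (hP : (legProduct μ : ℝ) ≤ (t - durfee μ) * (t ^ 2 - lowerLeg μ))
    (i : ℕ) : ∑ j ∈ range (μ.rowLen i), durfeeWeight μ t j ≤ t * durfeeWeight μ t i := by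
  rcases lt_or_ge i (durfee μ) with hi | hi
  · rw [← sum_range_add_sum_Ico _ (durfee_le_rowLen μ hi), sum_range_durfee_durfeeWeight,
      sum_congr rfl fun j hj => durfeeWeight_of_le (mem_Ico.1 hj).1, ← mul_sum,
      durfeeWeight_of_lt hi]
    linarith
  · have hsquare : ∀ j ∈ range (μ.rowLen i), durfeeWeight μ t j ≤ t ^ 2 := fun j hj => by
      rw [durfeeWeight_of_lt ((mem_range.1 hj).trans_le (rowLen_le_durfee μ hi))]
      have hlow : ∑ k ∈ Ico (durfee μ) (μ.rowLen j), (μ.rowLen k : ℝ) ≤ lowerLeg μ := by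
        exact_mod_cast sum_Ico_rowLen_le_lowerLeg μ j
      linarith
    calc ∑ j ∈ range (μ.rowLen i), durfeeWeight μ t j ≤ #(range (μ.rowLen i)) • t ^ 2 :=
          sum_le_card_nsmul _ _ _ hsquare
      _ = t * durfeeWeight μ t i := by
          rw [durfeeWeight_of_le hi, card_range, nsmul_eq_mul]
          ring

theorem rowLen_le_mul_durfeeWeight (ht : 0 < t) (hN : lowerLeg μ < t ^ 2) (i : ℕ) :
    (μ.rowLen i : ℝ) ≤ (μ.card / (t ^ 2 - lowerLeg μ) + 1 / t) * durfeeWeight μ t i := by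
  have hpos : 0 < t ^ 2 - lowerLeg μ := sub_pos.2 hN
  rw [add_mul]
  rcases lt_or_ge i (durfee μ) with hi | hi
  · rw [durfeeWeight_of_lt hi]
    calc (μ.rowLen i : ℝ) ≤ μ.card := by exact_mod_cast rowLen_le_card μ i
      _ = μ.card / (t ^ 2 - lowerLeg μ) * (t ^ 2 - lowerLeg μ) := (div_mul_cancel₀ _ hpos.ne').symm
      _ ≤ μ.card / (t ^ 2 - lowerLeg μ) *
            (t ^ 2 - lowerLeg μ + ∑ j ∈ Ico (durfee μ) (μ.rowLen i), (μ.rowLen j : ℝ)) := by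
          gcongr
          exact le_add_of_nonneg_right (by positivity)
      _ ≤ _ := le_add_of_nonneg_right (by positivity)
  · rw [durfeeWeight_of_le hi]
    calc (μ.rowLen i : ℝ) = 1 / t * (t * μ.rowLen i) := by field_simp
      _ ≤ _ := le_add_of_nonneg_left (by positivity)

theorem hasGrowth_of_lowerLeg (ht : 0 < t) (hN : lowerLeg μ < t ^ 2)
    (hP : (legProduct μ : ℝ) ≤ (t - durfee μ) * (t ^ 2 - lowerLeg μ)) : HasGrowth μ.cells t := by
  have hK : 0 ≤ μ.card / (t ^ 2 - lowerLeg μ) + 1 / t :=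
    add_nonneg (div_nonneg (Nat.cast_nonneg _) (sub_nonneg.2 hN.le)) (one_div_nonneg.2 ht.le)
  refine hasGrowth_of_sum_le (x := durfeeWeight μ t) ht.le hK (fun i => ?_) fun i => ?_
  · rw [outDegree, ← YoungDiagram.row, ← YoungDiagram.rowLen_eq_card]
    exact rowLen_le_mul_durfeeWeight ht hN i
  · rw [sum_cells_fst_eq]
    exact sum_durfeeWeight_le hP i

theorem hasGrowth_of_minLeg (ht : 0 < t) (hN : minLeg μ < t ^ 2)
    (hP : (legProduct μ : ℝ) ≤ (t - durfee μ) * (t ^ 2 - minLeg μ)) : HasGrowth μ.cells t := by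
  rcases min_choice (lowerLeg μ) (rightLeg μ) with h | h <;> rw [minLeg, h] at hN hP
  · exact hasGrowth_of_lowerLeg ht hN hP
  · rw [← hasGrowth_reverse, ← cells_transpose]
    refine hasGrowth_of_lowerLeg ht ?_ ?_
    · rwa [lowerLeg_transpose]
    · rwa [lowerLeg_transpose, legProduct_transpose, durfee_transpose]

theorem minLeg_eq_zero_of_durfee_eq_zero (h : durfee μ = 0) : minLeg μ = 0 := by
  have hlow : lowerLeg μ = 0 :=
    sum_eq_zero fun i hi => Nat.le_zero.1 (h ▸ rowLen_le_durfee μ (mem_Ico.1 hi).1)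
  rw [minLeg, hlow, Nat.zero_min]

theorem hasGrowth_of_card_le (ht : 0 < t) (h : (μ.card : ℝ) ≤ t ^ 2 + (t - durfee μ) ^ 2) :
    HasGrowth μ.cells t := by
  have hcard : 2 * (minLeg μ : ℝ) + durfee μ ^ 2 ≤ μ.card := by
    exact_mod_cast two_mul_minLeg_add_durfee_sq_le μ
  have hN : (minLeg μ : ℝ) ≤ t * (t - durfee μ) := by linarith
  have hP : (legProduct μ : ℝ) ≤ durfee μ * minLeg μ := by
    exact_mod_cast legProduct_le_durfee_mul_minLeg μ
  refine hasGrowth_of_minLeg ht ?_ (hP.trans ?_)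
  · rcases Nat.eq_zero_or_pos (durfee μ) with hd | hd
    · rw [minLeg_eq_zero_of_durfee_eq_zero hd, Nat.cast_zero]
      positivity
    · have : 0 < t * durfee μ := by positivity
      linarith
  · linarith [mul_le_mul_of_nonneg_left hN ht.le]

theorem hasGrowth_of_durfee_eq {m l : ℕ} (hd : durfee μ = m) (hcard : μ.card = m ^ 2 + l)
    (ht : 0 < t) (hmt : m ≤ t) (hp : ((l / 2 : ℕ) : ℝ) < t ^ 2)
    (hpq : ((l / 2 : ℕ) : ℝ) * ((l + 1) / 2 : ℕ) ≤ (t - m) * (t ^ 2 - (l / 2 : ℕ))) :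
    HasGrowth μ.cells t := by
  have hleg : minLeg μ ≤ l / 2 := by
    have := two_mul_minLeg_add_durfee_sq_le μ
    rw [hd, hcard] at this
    lia
  have hN : (minLeg μ : ℝ) ≤ (l / 2 : ℕ) := by exact_mod_cast hleg
  have hl : ((l / 2 : ℕ) : ℝ) + ((l + 1) / 2 : ℕ) = l := by
    exact_mod_cast (by lia : l / 2 + (l + 1) / 2 = l)
  have hle : ((l / 2 : ℕ) : ℝ) ≤ ((l + 1) / 2 : ℕ) := by
    exact_mod_cast (by lia : l / 2 ≤ (l + 1) / 2)
  have hP := legProduct_le_minLeg_mul μ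
  rw [hd, hcard, Nat.cast_add, Nat.cast_pow, add_sub_cancel_left] at hP
  refine hasGrowth_of_minLeg ht (hN.trans_lt hp) ?_
  rw [hd]
  calc (legProduct μ : ℝ) ≤ minLeg μ * (l - minLeg μ) := hP
    _ ≤ (l / 2 : ℕ) * ((l + 1) / 2 : ℕ) := by
        rw [← hl]
        linarith [mul_nonneg (sub_nonneg.2 hN) (sub_nonneg.2 (hN.trans hle))]
    _ ≤ (t - m) * (t ^ 2 - (l / 2 : ℕ)) := hpq
    _ ≤ (t - m) * (t ^ 2 - minLeg μ) :=
        mul_le_mul_of_nonneg_left (sub_le_sub_left hN _) (sub_nonneg.2 hmt)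

end Growth

section Bounds

variable {μ : YoungDiagram} {m l : ℕ}

theorem durfee_le_of_card_le (hl : l ≤ 2 * m) (hcard : μ.card = m ^ 2 + l) : durfee μ ≤ m := by
  have hsq := durfee_sq_add_lowerLeg_add_rightLeg μ
  by_contra! h
  nlinarith

theorem hasGrowth_of_card_eq_sq_add (hl : 1 ≤ l) (hlm : l ≤ 2 * m) (hcard : μ.card = m ^ 2 + l) :
    HasGrowth μ.cells (((m : ℝ) + √((m : ℝ) ^ 2 + 2 * l)) / 2) := by
  have hs : √((m : ℝ) ^ 2 + 2 * l) ^ 2 = (m : ℝ) ^ 2 + 2 * l := Real.sq_sqrt (by positivity)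
  have hms : (m : ℝ) ≤ √((m : ℝ) ^ 2 + 2 * l) := Real.le_sqrt_of_sq_le (by linarith)
  have hm : (0 : ℝ) < m := by exact_mod_cast (by lia : 0 < m)
  have hd : (durfee μ : ℝ) ≤ m := by exact_mod_cast durfee_le_of_card_le (by lia) hcard
  refine hasGrowth_of_card_le (by positivity) ?_
  set s := √((m : ℝ) ^ 2 + 2 * l)
  calc (μ.card : ℝ) = m ^ 2 + l := by rw [hcard]; push_cast; rfl
    _ = ((m + s) / 2) ^ 2 + ((m + s) / 2 - m) ^ 2 := by linear_combination -hs / 2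
    _ ≤ ((m + s) / 2) ^ 2 + ((m + s) / 2 - durfee μ) ^ 2 := by gcongr; linarith

/-- A Durfee square smaller than `m` needs no further argument when the excess over `m²` is at
most the square of the deficit. -/
theorem hasGrowth_of_le_sub_durfee_sq (hm : 0 < m) (hcard : μ.card = m ^ 2 + l)
    (hl : (l : ℝ) ≤ (m - durfee μ) ^ 2) : HasGrowth μ.cells m := by
  refine hasGrowth_of_card_le (by exact_mod_cast hm) ?_
  rw [hcard]
  push_cast
  linarith

theorem hasGrowth_of_card_eq_sq_add_one (hm : 1 ≤ m) (hcard : μ.card = m ^ 2 + 1) :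
    HasGrowth μ.cells m := by
  have hm' : (0 : ℝ) < m := by exact_mod_cast hm
  rcases (durfee_le_of_card_le (by lia) hcard).eq_or_lt with hd | hd
  · refine hasGrowth_of_durfee_eq hd hcard hm' le_rfl ?_ ?_
    · simpa using pow_pos hm' 2
    · simp
  · refine hasGrowth_of_le_sub_durfee_sq hm hcard ?_
    have : (durfee μ : ℝ) + 1 ≤ m := by exact_mod_cast hd
    rw [Nat.cast_one, one_le_sq_iff₀ (by linarith)]
    linarith

theorem hasGrowth_of_card_eq_sq_add_two_mul_sub_three (hlm : l + 3 = 2 * m)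
    (hcard : μ.card = m ^ 2 + l) :
    HasGrowth μ.cells (((m : ℝ) - 1 + √((m : ℝ) ^ 2 + 6 * m - 7)) / 2) := by
  have hm : (2 : ℝ) ≤ m := by exact_mod_cast (by lia : 2 ≤ m)
  have hlm' : (l : ℝ) + 3 = 2 * m := by exact_mod_cast hlm
  have hs : √((m : ℝ) ^ 2 + 6 * m - 7) ^ 2 = (m : ℝ) ^ 2 + 6 * m - 7 :=
    Real.sq_sqrt (by nlinarith)
  have hms : (m : ℝ) + 1 ≤ √((m : ℝ) ^ 2 + 6 * m - 7) := Real.le_sqrt_of_sq_le (by linarith)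
  set s := √((m : ℝ) ^ 2 + 6 * m - 7)
  set t := ((m : ℝ) - 1 + s) / 2 with ht
  have hmt : (m : ℝ) ≤ t := by linarith
  have hroot : t ^ 2 = (m - 1) * t + 2 * (m - 1) := by rw [ht]; linear_combination hs / 4
  rcases (durfee_le_of_card_le (by lia) hcard).eq_or_lt with hd | hd
  · have hp : ((l / 2 : ℕ) : ℝ) = m - 2 := by
      rw [eq_sub_iff_add_eq]; exact_mod_cast (by lia : l / 2 + 2 = m)
    have hq : (((l + 1) / 2 : ℕ) : ℝ) = m - 1 := by
      rw [eq_sub_iff_add_eq]; exact_mod_cast (by lia : (l + 1) / 2 + 1 = m)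
    refine hasGrowth_of_durfee_eq hd hcard (by linarith) hmt ?_ ?_
    · rw [hp]
      nlinarith
    · rw [hp, hq, hroot]
      nlinarith
  · refine hasGrowth_of_card_le (by linarith) ?_
    have hd' : (durfee μ : ℝ) + 1 ≤ m := by exact_mod_cast hd
    calc (μ.card : ℝ) = m ^ 2 + l := by rw [hcard]; push_cast; rfl
      _ = t ^ 2 + (t - (m - 1)) ^ 2 := by linear_combination hlm' - 2 * hroot
      _ ≤ t ^ 2 + (t - durfee μ) ^ 2 := by gcongr <;> linarith

theorem sum_sq_le_of_antitone {R : Type*} [CommRing R] [LinearOrder R] [IsStrictOrderedRing R]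
    {x : ℕ → R} {n s : ℕ} {B w : R} (hx : Antitone x) (hx0 : ∀ i, 0 ≤ x i) (hxB : ∀ i, x i ≤ B)
    (hw : 0 < w) (hwB : w ≤ B) (hsum : ∑ i ∈ range n, x i = s * B + w) :
    ∑ i ∈ range n, x i ^ 2 ≤ s * B ^ 2 + w ^ 2 := by
  have hsn : s < n := by
    by_contra! hns
    have hle : ∑ i ∈ range n, x i ≤ n * B := by
      simpa using sum_le_card_nsmul (range n) x B fun i _ => hxB i
    have : (n : R) * B ≤ s * B := by
      gcongr
      exact hw.le.trans hwB
    linarith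
  have hhead : ∑ i ∈ range s, x i ^ 2 ≤ (B + x s) * (∑ i ∈ range s, x i) - s * (B * x s) := by
    have hterm : ∀ i ∈ range s, x i ^ 2 ≤ (B + x s) * x i - B * x s := fun i hi => by
      linarith [mul_nonneg (sub_nonneg.2 (hxB i)) (sub_nonneg.2 (hx (mem_range.1 hi).le))]
    simpa [sum_sub_distrib, mul_sum] using sum_le_sum hterm
  have htail : ∑ i ∈ Ico s n, x i ^ 2 ≤ x s * ∑ i ∈ Ico s n, x i := by
    rw [mul_sum]
    refine sum_le_sum fun i hi => ?_
    rw [sq]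
    exact mul_le_mul_of_nonneg_right (hx (mem_Ico.1 hi).1) (hx0 i)
  have hhead_le : ∑ i ∈ range s, x i ≤ s * B := by
    simpa using sum_le_card_nsmul (range s) x B fun i _ => hxB i
  have hle_tail : x s ≤ ∑ i ∈ Ico s n, x i :=
    single_le_sum (fun i _ => hx0 i) (left_mem_Ico.2 hsn)
  rw [← sum_range_add_sum_Ico _ hsn.le] at hsum ⊢
  nlinarith [mul_nonneg (sub_nonneg.2 hwB) (sub_nonneg.2 hhead_le),
    mul_nonneg hw.le (sub_nonneg.2 hle_tail)]

/-- The sum `colLen + rowLen` over the vertices beyond the Durfee square is at most `2 * durfee`,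
so the sum of its squares is largest when the mass is concentrated on `s` full vertices. -/
theorem four_mul_legProduct_le {s w : ℕ} (hw : 0 < w) (hwd : w ≤ 2 * durfee μ)
    (h : lowerLeg μ + rightLeg μ = 2 * durfee μ * s + w) :
    4 * (legProduct μ : ℝ) ≤ 4 * durfee μ ^ 2 * s + w ^ 2 := by
  let x (i : ℕ) : ℝ := μ.colLen (durfee μ + i) + μ.rowLen (durfee μ + i)
  have hx : Antitone x := fun i j hij => by
    have := μ.colLen_anti _ _ (Nat.add_le_add_left hij (durfee μ))
    have := μ.rowLen_anti _ _ (Nat.add_le_add_left hij (durfee μ))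
    dsimp only [x]
    gcongr
  have hxB (i : ℕ) : x i ≤ 2 * durfee μ := by
    have := colLen_le_durfee μ (Nat.le_add_right _ i)
    have := rowLen_le_durfee μ (Nat.le_add_right _ i)
    dsimp only [x]
    exact_mod_cast (by lia : _ + _ ≤ 2 * durfee μ)
  have hsum : ∑ i ∈ range (μ.card - durfee μ), x i = s * (2 * durfee μ) + w := by
    rw [← sum_Ico_eq_sum_range (fun j => (μ.colLen j + μ.rowLen j : ℝ)), sum_add_distrib]
    have : (lowerLeg μ + rightLeg μ : ℝ) = 2 * durfee μ * s + w := by exact_mod_cast h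
    simp only [lowerLeg, rightLeg, Nat.cast_sum] at this
    linarith
  have hsq := sum_sq_le_of_antitone hx (fun i => by positivity) hxB (by exact_mod_cast hw)
    (by exact_mod_cast hwd) hsum
  calc 4 * (legProduct μ : ℝ)
      = ∑ i ∈ range (μ.card - durfee μ),
          4 * ((μ.colLen (durfee μ + i) : ℝ) * μ.rowLen (durfee μ + i)) := by
        rw [legProduct, sum_Ico_eq_sum_range, Nat.cast_sum, mul_sum]
        simp only [Nat.cast_mul]
    _ ≤ ∑ i ∈ range (μ.card - durfee μ), x i ^ 2 :=
        sum_le_sum fun i _ => by simpa only [mul_assoc] using four_mul_le_sq_add _ _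
    _ ≤ 4 * durfee μ ^ 2 * s + w ^ 2 := by linarith

/-- Here `r` is the deficit `m - durfee μ`. Shrinking the Durfee square by `r` costs about
`r² * durfee μ`, which outweighs `l²` once `durfee μ` is large compared with `l`. -/
theorem hasGrowth_of_sq_lt {r : ℕ} (hm : durfee μ + r = m) (hcard : μ.card = m ^ 2 + l)
    (hr : 0 < r) (hrl : r ^ 2 < l) (hd : l ^ 2 + l ≤ durfee μ) : HasGrowth μ.cells m := by
  subst hm
  have hlegs : lowerLeg μ + rightLeg μ = 2 * durfee μ * r + (r ^ 2 + l) := by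
    have := durfee_sq_add_lowerLeg_add_rightLeg μ
    rw [hcard] at this
    linarith
  have hP := four_mul_legProduct_le (by lia) (by nlinarith) hlegs
  have hN : 2 * (minLeg μ : ℝ) + durfee μ ^ 2 ≤ (durfee μ + r) ^ 2 + l := by
    exact_mod_cast hcard ▸ two_mul_minLeg_add_durfee_sq_le μ
  have hr' : (1 : ℝ) ≤ r := by exact_mod_cast hr
  have hrl' : (r : ℝ) ^ 2 ≤ l := by exact_mod_cast hrl.le
  have hd' : (l : ℝ) ^ 2 + l ≤ durfee μ := by exact_mod_cast hd
  have hleg : (minLeg μ : ℝ) ≤ durfee μ * r + l := by linarith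
  have hP' : (legProduct μ : ℝ) ≤ durfee μ ^ 2 * r + l ^ 2 := by
    have : ((r : ℝ) ^ 2 + l) ^ 2 ≤ (l + l) ^ 2 := by gcongr
    push_cast at hP
    linarith
  have hgain : (l : ℝ) ^ 2 + r * l ≤ r ^ 2 * durfee μ :=
    calc (l : ℝ) ^ 2 + r * l ≤ (r : ℝ) ^ 2 * (l : ℝ) ^ 2 + (r : ℝ) ^ 2 * l := by
          gcongr
          · exact le_mul_of_one_le_left (sq_nonneg _) (one_le_pow₀ hr')
          · exact le_self_pow₀ hr' two_ne_zero
      _ = (r : ℝ) ^ 2 * ((l : ℝ) ^ 2 + l) := by ring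
      _ ≤ (r : ℝ) ^ 2 * durfee μ := by gcongr
  refine hasGrowth_of_minLeg (by positivity) ?_ ?_ <;> push_cast
  · nlinarith
  · calc (legProduct μ : ℝ) ≤ durfee μ ^ 2 * r + l ^ 2 := hP'
      _ ≤ r * ((durfee μ + r) ^ 2 - (durfee μ * r + l)) := by
          linarith [pow_nonneg (zero_le_one.trans hr') 3]
      _ ≤ (durfee μ + r - durfee μ) * ((durfee μ + r) ^ 2 - minLeg μ) := by
          rw [add_sub_cancel_left]
          gcongr

theorem hasGrowth_of_root {ρ : ℝ} (hm : (l + 1) ^ 2 ≤ m) (hcard : μ.card = m ^ 2 + l)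
    (hmρ : m ≤ ρ) (hroot : (ρ - m) * (ρ ^ 2 - (l / 2 : ℕ)) = (l / 2 : ℕ) * ((l + 1) / 2 : ℕ)) :
    HasGrowth μ.cells ρ := by
  have hlm : l < m := by nlinarith
  have hm0 : 0 < m := by lia
  have hm' : (0 : ℝ) < m := by exact_mod_cast hm0
  rcases (durfee_le_of_card_le (by lia) hcard).eq_or_lt with hd | hd
  · refine hasGrowth_of_durfee_eq hd hcard (hm'.trans_le hmρ) hmρ ?_ hroot.ge
    have hp : l / 2 < m ^ 2 :=
      ((Nat.div_le_self l 2).trans_lt hlm).trans_le (Nat.le_self_pow two_ne_zero m)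
    calc ((l / 2 : ℕ) : ℝ) < m ^ 2 := by exact_mod_cast hp
      _ ≤ ρ ^ 2 := by gcongr
  obtain ⟨r, hr⟩ := Nat.exists_eq_add_of_lt hd
  refine HasGrowth.mono ?_ hm'.le hmρ
  rcases le_or_gt l ((r + 1) ^ 2) with hl | hl
  · refine hasGrowth_of_le_sub_durfee_sq hm0 hcard ?_
    rw [hr]
    push_cast
    calc (l : ℝ) ≤ (r + 1) ^ 2 := by exact_mod_cast hl
      _ = (durfee μ + r + 1 - durfee μ) ^ 2 := by ring
  · exact hasGrowth_of_sq_lt hr.symm hcard r.succ_pos hl (by nlinarith)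

end Bounds

section NormalSet

variable {F M ι : Type*} [Field F] [AddCommGroup M] [Module F M] [LinearOrder ι]

/-- The indices `i` for which `f i` is not a linear combination of the earlier members of the
family `f`; over them `f` is a basis of its span. -/
def normalSet (F : Type*) {M ι : Type*} [Field F] [AddCommGroup M] [Module F M] [LinearOrder ι]
    (f : ι → M) : Set ι :=
  {i | f i ∉ Submodule.span F (f '' Set.Iio i)}

theorem linearIndepOn_normalSet (f : ι → M) : LinearIndepOn F f (normalSet F f) := by
  refine linearIndepOn_iff'.2 fun s g hs hg => ?_
  induction s using Finset.induction_on_max with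
  | empty => simp
  | insert a s hmax ih =>
    have ha : a ∉ s := fun ha => (hmax a ha).false
    rw [coe_insert, Set.insert_subset_iff] at hs
    rw [sum_insert ha] at hg
    have hga : g a = 0 := by
      by_contra hga
      refine hs.1 ((Submodule.smul_mem_iff _ hga).1 ?_)
      rw [eq_neg_of_add_eq_zero_left hg]
      exact neg_mem (Submodule.sum_mem _ fun i hi =>
        Submodule.smul_mem _ _ (Submodule.subset_span (Set.mem_image_of_mem f (hmax i hi))))
    rw [hga, zero_smul, zero_add] at hg
    exact (forall_mem_insert _ _ _).2 ⟨hga, ih hs.2 hg⟩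

variable [WellFoundedLT ι]

theorem span_image_normalSet (f : ι → M) :
    Submodule.span F (f '' normalSet F f) = Submodule.span F (Set.range f) := by
  refine le_antisymm (Submodule.span_mono (Set.image_subset_range f _)) (Submodule.span_le.2 ?_)
  rintro _ ⟨i, rfl⟩
  induction i using WellFoundedLT.induction with
  | ind i ih =>
    by_cases hi : i ∈ normalSet F f
    · exact Submodule.subset_span (Set.mem_image_of_mem f hi)
    · refine Submodule.span_le.2 ?_ (not_not.1 hi)
      rintro _ ⟨j, hj, rfl⟩
      exact ih j hj

/-- The basis of the span of the family `f` formed by its members outside the span of the earlier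
ones. -/
noncomputable def normalBasis (F : Type*) {M ι : Type*} [Field F] [AddCommGroup M] [Module F M]
    [LinearOrder ι] [WellFoundedLT ι] (f : ι → M) :
    Module.Basis (normalSet F f) F (Submodule.span F (Set.range f)) :=
  (Module.Basis.span (linearIndepOn_normalSet f)).map
    (LinearEquiv.ofEq _ _ (by rw [← Set.image_eq_range, span_image_normalSet]))

end NormalSet

section Words

variable {F A X : Type*} [Field F] [Ring A] [Algebra F A]

open Pointwise in
theorem span_range_pow (v : X → A) (n : ℕ) :
    Submodule.span F (Set.range v) ^ n =
      Submodule.span F ((fun l : List X => (l.map v).prod) '' {l | l.length = n}) := by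
  rw [Submodule.span_pow]
  congr 1
  induction n with
  | zero => simp [List.length_eq_zero_iff, Set.singleton_one]
  | succ n ih =>
    rw [pow_succ', ih]
    ext a
    simp only [Set.mem_mul, Set.mem_range, Set.mem_image, Set.mem_ofPred_eq]
    constructor
    · rintro ⟨_, ⟨x, rfl⟩, _, ⟨l, rfl, rfl⟩, rfl⟩
      exact ⟨x :: l, rfl, List.prod_cons⟩
    · rintro ⟨l, hl, rfl⟩
      obtain ⟨x, l, rfl⟩ := List.exists_cons_of_length_eq_add_one hl
      exact ⟨v x, ⟨x, rfl⟩, _, ⟨l, Nat.succ_injective hl, rfl⟩, List.prod_cons.symm⟩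

theorem span_range_sq (v : X → A) :
    Submodule.span F (Set.range v) ^ 2 =
      Submodule.span F (Set.range fun c : X ×ₗ X => v (ofLex c).1 * v (ofLex c).2) := by
  rw [sq, Submodule.span_mul_span]
  congr 1
  ext a
  simp [Set.mem_mul, Lex.exists, Prod.exists]

variable [LinearOrder X]

/-- The normal words of length two in the letters `v`: the pairs `(x, y)` for which `v x * v y` is
not a linear combination of the products of lexicographically smaller pairs. -/
def normalPairs (F : Type*) {A X : Type*} [Field F] [Ring A] [Algebra F A] [LinearOrder X]
    (v : X → A) : Set (X × X) :=
  toLex ⁻¹' normalSet F fun c : X ×ₗ X => v (ofLex c).1 * v (ofLex c).2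

theorem ncard_normalPairs [WellFoundedLT X] (v : X → A) :
    (normalPairs F v).ncard = Module.finrank F ↥(Submodule.span F (Set.range v) ^ 2) := by
  rw [span_range_sq, Module.finrank_eq_nat_card_basis (normalBasis F _), Nat.card_coe_set_eq]
  exact Set.ncard_preimage_of_injective_subset_range toLex.injective (by simp)

theorem finite_normalPairs [WellFoundedLT X] (v : X → A)
    [Module.Finite F ↥(Submodule.span F (Set.range v) ^ 2)] : (normalPairs F v).Finite := by
  have := Module.Finite.equiv (LinearEquiv.ofEq _ _ (span_range_sq (F := F) v))
  have := Module.Finite.finite_basis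
    (normalBasis F fun c : X ×ₗ X => v (ofLex c).1 * v (ofLex c).2)
  exact (Set.toFinite _).preimage toLex.injective.injOn

/-- A non-normal factor of length two can be replaced by a combination of smaller ones, which makes
the whole word smaller in the length-lexicographic order. -/
theorem prod_map_mem_span_isChain [WellFoundedLT X] (v : X → A) (l : List X) :
    (l.map v).prod ∈ Submodule.span F ((fun l : List X => (l.map v).prod) ''
      {l' | l'.length = l.length ∧ l'.IsChain fun x y => (x, y) ∈ normalPairs F v}) := by
  induction l using (List.Shortlex.wf (wellFounded_lt (α := X))).induction with
  | _ l ih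
  by_cases hl : l.IsChain fun x y => (x, y) ∈ normalPairs F v
  · exact Submodule.subset_span ⟨l, ⟨rfl, hl⟩, rfl⟩
  rw [List.isChain_iff_forall_rel_of_append_cons_cons] at hl
  push Not at hl
  obtain ⟨x, y, l₁, l₂, rfl, hxy⟩ := hl
  have hsplit (a b : X) : ((l₁ ++ a :: b :: l₂).map v).prod =
      LinearMap.mulLeftRight F ((l₁.map v).prod, (l₂.map v).prod) (v a * v b) := by
    simp [mul_assoc]
  rw [hsplit, ← Submodule.mem_comap]
  refine Submodule.span_le.2 ?_ (not_not.1 hxy)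
  rintro _ ⟨c, hc, rfl⟩
  have hlex : List.Lex (· < ·) ((ofLex c).1 :: (ofLex c).2 :: l₂) (x :: y :: l₂) := by
    rcases Prod.Lex.lt_iff.1 hc with h | ⟨h, h'⟩
    · exact .rel h
    · exact h ▸ .cons (.rel h')
  have := ih _ ((List.Shortlex.of_lex (by rfl) hlex).append_left l₁)
  rw [hsplit] at this
  rw [SetLike.mem_coe, Submodule.mem_comap]
  simpa only [List.length_append, List.length_cons] using this

end Words

section Hilbert

variable {F A X : Type*} [Field F] [Ring A] [Algebra F A] [LinearOrder X] [WellFoundedLT X]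

theorem finrank_pow_add_two_le {v : X → A} {E : Finset (X × X)} (hE : normalPairs F v = E)
    (n : ℕ) :
    Module.finrank F ↥(Submodule.span F (Set.range v) ^ (n + 2)) ≤ edgeWalkCount E n := by
  classical
  let S : Finset A := (E.biUnion fun e => (walks E n e.2).image (List.cons e.1)).image
    fun l => (l.map v).prod
  have hle : Submodule.span F (Set.range v) ^ (n + 2) ≤ Submodule.span F (S : Set A) := by
    rw [span_range_pow, Submodule.span_le]
    rintro _ ⟨l, hl, rfl⟩
    refine Submodule.span_mono ?_ (prod_map_mem_span_isChain v l)
    rintro _ ⟨l', ⟨hl', hchain⟩, rfl⟩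
    rw [hl.out] at hl'
    obtain ⟨x, l', rfl⟩ := List.exists_cons_of_length_eq_add_one hl'
    obtain ⟨y, l', rfl⟩ := List.exists_cons_of_length_eq_add_one (Nat.succ_injective hl')
    obtain rfl : l'.length = n := by simpa using hl'
    simp only [hE, mem_coe] at hchain
    obtain ⟨hxy, hchain⟩ := List.isChain_cons_cons.1 hchain
    exact mem_image_of_mem _ (mem_biUnion.2
      ⟨(x, y), hxy, mem_image_of_mem _ (mem_walks_of_isChain hchain)⟩)
  calc Module.finrank F ↥(Submodule.span F (Set.range v) ^ (n + 2))
      ≤ Module.finrank F (Submodule.span F (S : Set A)) := Submodule.finrank_mono hle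
    _ ≤ #S := finrank_span_finset_le_card S
    _ ≤ ∑ e ∈ E, #(walks E n e.2) :=
        card_image_le.trans (card_biUnion_le.trans (sum_le_sum fun e _ => card_image_le))
    _ ≤ edgeWalkCount E n := sum_le_sum fun e _ => card_walks_le E n e.2

/-- The exponential growth rate `limsup (dim V ^ n) ^ (1 / n)` of the powers of a subspace `V` of an
`F`-algebra. If `dim V ^ 2` is finite then `dim V ^ n` grows at most exponentially, so the real
limsup is the true one. -/
noncomputable def growthRate {F A : Type*} [Field F] [Ring A] [Algebra F A] (V : Submodule F A) :
    ℝ :=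
  Filter.limsup (fun n : ℕ => (Module.finrank F ↥(V ^ n) : ℝ) ^ (1 / (n : ℝ))) Filter.atTop

theorem limsup_rpow_le_of_le_geometric {a : ℕ → ℝ} {t K : ℝ} (ht : 0 < t)
    (ha : ∀ n, 0 ≤ a n) (h : ∀ n, a (n + 2) ≤ K * t ^ n) :
    Filter.limsup (fun n : ℕ => a n ^ (1 / (n : ℝ))) Filter.atTop ≤ t := by
  set L : ℝ := max 1 (K / t ^ 2)
  have hL : 0 < L := zero_lt_one.trans_le (le_max_left _ _)
  have hlim : Filter.Tendsto (fun n : ℕ => L ^ (1 / (n : ℝ)) * t) Filter.atTop (nhds t) := by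
    have hone : Filter.Tendsto (fun n : ℕ => L ^ (1 / (n : ℝ))) Filter.atTop
        (nhds (L ^ (0 : ℝ))) :=
      (Real.continuousAt_const_rpow hL.ne').tendsto.comp tendsto_one_div_atTop_nhds_zero_nat
    simpa only [Real.rpow_zero, one_mul] using hone.mul_const t
  have hle : ∀ᶠ n : ℕ in Filter.atTop, a n ^ (1 / (n : ℝ)) ≤ L ^ (1 / (n : ℝ)) * t := by
    filter_upwards [Filter.eventually_ge_atTop 2] with n hn
    obtain ⟨k, rfl⟩ := Nat.exists_eq_add_of_le' hn
    have hgeom : a (k + 2) ≤ L * t ^ (k + 2) :=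
      calc a (k + 2) ≤ K * t ^ k := h k
        _ = K / t ^ 2 * t ^ (k + 2) := by field_simp; ring
        _ ≤ L * t ^ (k + 2) := by gcongr; exact le_max_right _ _
    calc a (k + 2) ^ (1 / ((k + 2 : ℕ) : ℝ))
        ≤ (L * t ^ (k + 2)) ^ (1 / ((k + 2 : ℕ) : ℝ)) := by gcongr; exact ha _
      _ = L ^ (1 / ((k + 2 : ℕ) : ℝ)) * t := by
          rw [Real.mul_rpow hL.le (by positivity), one_div,
            Real.pow_rpow_inv_natCast ht.le (Nat.succ_ne_zero _)]
  rw [← hlim.limsup_eq]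
  exact Filter.limsup_le_limsup hle
    (Filter.isCoboundedUnder_le_of_le Filter.atTop (x := 0) fun n => Real.rpow_nonneg (ha n) _)
    hlim.isBoundedUnder_le

theorem growthRate_le_of_forall_hasGrowth {F A : Type*} [Field F] [Ring A] [Algebra F A]
    {V : Submodule F A} {t : ℝ} (ht : 0 < t) (hV : 0 < Module.finrank F ↥(V ^ 2))
    (h : ∀ μ : YoungDiagram, μ.card = Module.finrank F ↥(V ^ 2) → HasGrowth μ.cells t) :
    growthRate V ≤ t := by
  obtain ⟨_, _⟩ := exists_wellFoundedLT V
  let v : V → A := Subtype.val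
  have hv : Submodule.span F (Set.range v) = V := by
    rw [Subtype.range_coe]
    exact V.span_eq
  have : Module.Finite F ↥(Submodule.span F (Set.range v) ^ 2) := by
    rw [hv]
    exact Module.finite_of_finrank_pos hV
  let E := (finite_normalPairs (F := F) v).toFinset
  have hE : normalPairs F v = E := (Set.Finite.coe_toFinset _).symm
  have hcard : #E = Module.finrank F ↥(V ^ 2) := by
    rw [← Set.ncard_coe_finset, ← hE, ncard_normalPairs, hv]
  obtain ⟨K, hK⟩ := hasGrowth_of_hasGrowth_degreeDiagram
    (h (degreeDiagram E) ((card_degreeDiagram E).trans hcard))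
  refine limsup_rpow_le_of_le_geometric ht (fun _ => Nat.cast_nonneg _) fun n =>
    (Nat.cast_le.2 ?_).trans (hK n)
  have := finrank_pow_add_two_le hE n
  rwa [hv] at this

variable {F X : Type*} [Field F] (I : Ideal (FreeAlgebra F X)) [I.IsTwoSided]

theorem hilbertFn_eq_finrank_pow (n : ℕ) :
    hilbertFn I n = Module.finrank F ↥(quotientPart I 1 ^ n) := by
  rw [hilbertFn, quotientPart, quotientPart, ← Submodule.map_pow, degreePart, degreePart, pow_one]

theorem entropy_eq_growthRate : entropy I = growthRate (quotientPart I 1) := by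
  simp only [entropy, growthRate, hilbertFn_eq_finrank_pow]

end Hilbert

section Roots

/-- `t³ - m t² - p t + m p - p q = (t - m) (t² - p) - p q`, where both factors increase on
`t ≥ m`. -/
theorem exists_isLargestPositiveRoot {m p : ℕ} (q : ℕ) (hp : p < m ^ 2) :
    ∃ ρ : ℝ, IsLargestPositiveRoot m p q ρ ∧ (m : ℝ) ≤ ρ ∧ (ρ - m) * (ρ ^ 2 - p) = p * q := by
  have hm : (0 : ℝ) < m := by
    exact_mod_cast Nat.pos_of_ne_zero fun h => by simp [h] at hp
  have hp' : (p : ℝ) + 1 ≤ m ^ 2 := by exact_mod_cast hp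
  have hpq : (0 : ℝ) ≤ p * q := by positivity
  obtain ⟨ρ, ⟨hmρ, -⟩, hρ⟩ : (p * q : ℝ) ∈
      (fun t : ℝ => (t - m) * (t ^ 2 - p)) '' Set.Icc (m : ℝ) (m + p * q) := by
    refine intermediate_value_Icc (le_add_of_nonneg_right hpq) (by fun_prop)
      ⟨by simpa only [sub_self, zero_mul] using hpq, ?_⟩
    simp only [add_sub_cancel_left]
    exact le_mul_of_one_le_right hpq (by nlinarith)
  dsimp only at hρ
  refine ⟨ρ, ⟨⟨hm.trans_le hmρ, by linarith⟩, fun t ⟨_, ht⟩ => ?_⟩, hmρ, hρ⟩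
  by_contra! hlt
  have hlt' : (ρ - m) * (ρ ^ 2 - p) < (t - m) * (t ^ 2 - p) := by
    have hmρ' : (m : ℝ) ^ 2 ≤ ρ ^ 2 := by gcongr
    have hρt : ρ ^ 2 < t ^ 2 := by gcongr; exact hm.le.trans hmρ
    exact mul_lt_mul'' (by linarith) (by linarith) (by linarith) (by linarith)
  linarith

theorem half_add_sqrt_lt_sqrt {a b : ℝ} (hb : 0 < b) :
    (a + √(a ^ 2 + 2 * b)) / 2 < √(a ^ 2 + b) := by
  have hs : √(a ^ 2 + 2 * b) ^ 2 = a ^ 2 + 2 * b := Real.sq_sqrt (by positivity)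
  have hsa : a < √(a ^ 2 + 2 * b) := Real.lt_sqrt_of_sq_lt (by linarith)
  refine Real.lt_sqrt_of_sq_lt ?_
  linarith [pow_pos (sub_pos.2 hsa) 2]

end Roots

end EntropyBounds

open EntropyBounds in
theorem theorem1_general :
    (∀ (F : Type u) (A : Type v) [Field F] [Ring A] [Algebra F A] (V : Submodule F A) (m l : ℕ),
      1 ≤ l → l ≤ 2 * m → Module.finrank F ↥(V ^ 2) = m ^ 2 + l →
        growthRate V ≤ ((m : ℝ) + √((m : ℝ) ^ 2 + 2 * l)) / 2 ∧
        ((m : ℝ) + √((m : ℝ) ^ 2 + 2 * l)) / 2 < √(Module.finrank F ↥(V ^ 2) : ℝ) ∧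
        (l = 1 → growthRate V ≤ m) ∧
        (l + 3 = 2 * m → growthRate V ≤ ((m : ℝ) - 1 + √((m : ℝ) ^ 2 + 6 * m - 7)) / 2)) ∧
    (∀ l m : ℕ, (l + 1) ^ 2 ≤ m →
      ∃ ρ : ℝ, IsLargestPositiveRoot m (l / 2) ((l + 1) / 2) ρ ∧
        ∀ (F : Type u) (A : Type v) [Field F] [Ring A] [Algebra F A] (V : Submodule F A),
          Module.finrank F ↥(V ^ 2) = m ^ 2 + l → growthRate V ≤ ρ) := by
  refine ⟨fun F A _ _ _ V m l hl hlm hk => ?_, fun l m hm => ?_⟩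
  · have hpos : 0 < Module.finrank F ↥(V ^ 2) := by lia
    have hm : (0 : ℝ) < m := by exact_mod_cast (by lia : 0 < m)
    refine ⟨growthRate_le_of_forall_hasGrowth (by positivity) hpos fun μ hμ =>
      hasGrowth_of_card_eq_sq_add hl hlm (hμ.trans hk), ?_, ?_, fun hlm' => ?_⟩
    · rw [hk]
      exact_mod_cast half_add_sqrt_lt_sqrt (a := m) (b := l) (by exact_mod_cast hl)
    · rintro rfl
      exact growthRate_le_of_forall_hasGrowth hm hpos fun μ hμ =>
        hasGrowth_of_card_eq_sq_add_one (by exact_mod_cast hm) (hμ.trans hk)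
    · have hm2 : (1 : ℝ) < m := by exact_mod_cast (by lia : 1 < m)
      exact growthRate_le_of_forall_hasGrowth
        (half_pos (add_pos_of_pos_of_nonneg (sub_pos.2 hm2) (Real.sqrt_nonneg _))) hpos
        fun μ hμ => hasGrowth_of_card_eq_sq_add_two_mul_sub_three hlm' (hμ.trans hk)
  · have hlm : l < m := by nlinarith
    obtain ⟨ρ, hρ, hmρ, hroot⟩ := exists_isLargestPositiveRoot ((l + 1) / 2)
      (((Nat.div_le_self l 2).trans_lt hlm).trans_le (Nat.le_self_pow two_ne_zero m))
    refine ⟨ρ, hρ, fun F A _ _ _ V hk => ?_⟩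
    have hpos : 0 < Module.finrank F ↥(V ^ 2) := by have := Nat.le_self_pow two_ne_zero m; lia
    exact growthRate_le_of_forall_hasGrowth hρ.1.1 hpos fun μ hμ =>
      hasGrowth_of_root hm (hμ.trans hk) hmρ hroot

open EntropyBounds in
theorem theorem1 :
    (∀ (F : Type u) (X : Type v) [Field F] [Finite X]
      (I : Ideal (FreeAlgebra F X)) [I.IsTwoSided], I.IsHomogeneous (degreePart F X) →
      ∀ m l : ℕ, 1 ≤ l → l ≤ 2 * m → hilbertFn I 2 = m ^ 2 + l →
        entropy I ≤ ((m : ℝ) + √((m : ℝ) ^ 2 + 2 * l)) / 2 ∧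
        ((m : ℝ) + √((m : ℝ) ^ 2 + 2 * l)) / 2 < √(hilbertFn I 2 : ℝ) ∧
        (l = 1 → entropy I ≤ m) ∧
        (l + 3 = 2 * m → entropy I ≤ ((m : ℝ) - 1 + √((m : ℝ) ^ 2 + 6 * m - 7)) / 2)) ∧
    (∀ l : ℕ, ∃ M : ℕ, ∀ m : ℕ, M ≤ m →
      ∃ ρ : ℝ, IsLargestPositiveRoot m (l / 2) ((l + 1) / 2) ρ ∧
        ∀ (F : Type u) (X : Type v) [Field F] [Finite X]
          (I : Ideal (FreeAlgebra F X)) [I.IsTwoSided], I.IsHomogeneous (degreePart F X) →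
          hilbertFn I 2 = m ^ 2 + l → entropy I ≤ ρ) := by
  simp only [hilbertFn_eq_finrank_pow, entropy_eq_growthRate]
  exact ⟨fun F X _ _ I _ _ => theorem1_general.1 F _ (quotientPart I 1), fun l =>
    ⟨(l + 1) ^ 2, fun m hm => (theorem1_general.2 l m hm).imp fun _ h =>
      ⟨h.1, fun F X _ _ I _ _ => h.2 F _ (quotientPart I 1)⟩⟩⟩
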